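/- Let $\mathbf{Hilb}$ be the category of finite-dimensional complex Hilbert spaces and linear maps, with its usual tensor product, symmetry, duals $A^*$ and with the adjoint $f \mapsto f^\dagger$ of linear maps. A commutative $\dagger$-Frobenius monoid in $\mathbf{Hilb}$ is a triple $(A,m,u)$ consisting of an object $A$ and morphisms $m : A \otimes A \to A$ and $u : \mathbb{C} \to A$ that form a commutative, associative, unital monoid and satisfy $$(m \otimes \mathrm{id}_A)\circ(\mathrm{id}_A \otimes m^\dagger) \;=\; m^\dagger \circ m \;=\; (\mathrm{id}_A \otimes m)\circ(m^\dagger \otimes \mathrm{id}_A).$$ Its linear involution is $s_A := \bigl(\mathrm{id}_{A^*} \otimes (u^\dagger \circ m)\bigr)\circ(\epsilon_A \otimes \mathrm{id}_A) : A \to A^*$, where $\epsilon_A : \mathbb{C} \to A^* \otimes A$ is the canonical duality morphism, $1 \mapsto \sum_i e_i^* \otimes e_i$ for any basis $(e_i)$ of $A$ with dual basis $(e_i^*)$. A homomorphism of monoids $f : (A,m,u) \to (B,n,v)$ is involution-preserving if $s_B \circ f = f_* \circ s_A$, where $f_* := (f^\dagger)^* : A^* \to B^*$ is the transpose of $f^\dagger$.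 Let $\mathrm{C}(\mathbf{Hilb})$ be the category of commutative $\dagger$-Frobenius monoids in $\mathbf{Hilb}$ and involution-preserving monoid homomorphisms, and let $\mathbf{FinSet}$ be the category of finite sets and functions. Theorem. The category $\mathrm{C}(\mathbf{Hilb})$ is equivalent to the opposite of the category of finite sets: $$\mathrm{C}(\mathbf{Hilb}) \simeq \mathbf{FinSet}^{\mathrm{op}}.$$ -/

import Mathlib

open CategoryTheory MonoidalCategory
open scoped TensorProduct

/-! ### Monoidal dagger categories and their classical structures -/

/-- A dagger category: a category with a contravariant involutive endofunctor which is the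
identity on objects. -/
class DaggerCategory (Q : Type*) [Category Q] where
  /-- The adjoint `f† : B ⟶ A` of a morphism `f : A ⟶ B`. -/
  dag : ∀ {A B : Q}, (A ⟶ B) → (B ⟶ A)
  dag_id : ∀ A : Q, dag (𝟙 A) = 𝟙 A
  dag_comp : ∀ {A B C : Q} (f : A ⟶ B) (g : B ⟶ C), dag (f ≫ g) = dag g ≫ dag f
  dag_dag : ∀ {A B : Q} (f : A ⟶ B), dag (dag f) = f

open DaggerCategory

/-- A braided monoidal dagger category: the tensor product commutes with the dagger, and the
associator, the unitors and the braiding are unitary. -/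
class BraidedDaggerCategory (Q : Type*) [Category Q] [MonoidalCategory Q] [BraidedCategory Q]
    extends DaggerCategory Q where
  dag_tensorHom : ∀ {A B C D : Q} (f : A ⟶ B) (g : C ⟶ D), dag (f ⊗ₘ g) = dag f ⊗ₘ dag g
  dag_associator : ∀ A B C : Q, dag (α_ A B C).hom = (α_ A B C).inv
  dag_leftUnitor : ∀ A : Q, dag (λ_ A).hom = (λ_ A).inv
  dag_rightUnitor : ∀ A : Q, dag (ρ_ A).hom = (ρ_ A).inv
  dag_braiding : ∀ A B : Q, dag (β_ A B).hom = (β_ A B).inv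

/-- A choice of duals in a braided monoidal dagger category which is compatible with the dagger.
Every object `A` has a dual `A* = ᘁA`, with duality morphisms `η_ (ᘁA) A : I ⟶ A* ⊗ A` and
`ε_ (ᘁA) A : A ⊗ A* ⟶ I`; the resulting duality functor `(-)*` (written `ᘁf` on morphisms) has to
commute with the dagger. -/
class DaggerDuals (Q : Type*) [Category Q] [MonoidalCategory Q] [BraidedCategory Q]
    [BraidedDaggerCategory Q] extends LeftRigidCategory Q where
  dag_dual : ∀ {A B : Q} (f : A ⟶ B), dag (ᘁf) = ᘁ(dag f)

section ClassicalStructures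

variable (Q : Type*) [Category Q] [MonoidalCategory Q] [BraidedCategory Q]
  [BraidedDaggerCategory Q]

/-- A classical structure in `Q` is a commutative dagger-Frobenius monoid: a commutative monoid
`(A, m, u)` which forms a Frobenius structure with its adjoint comonoid `(A, m†, u†)`. (That
`(A, m†, u†)` is a comonoid is automatic.) -/
structure ClassicalStructure where
  /-- The underlying object. -/
  obj : Q
  [mon : MonObj obj]
  [comm : IsCommMonObj obj]
  /-- `(m ⊗ id) ∘ (id ⊗ m†) = m† ∘ m` -/
  frobenius_left : obj ◁ dag (MonObj.mul (X := obj)) ≫ (α_ obj obj obj).inv ≫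
      MonObj.mul (X := obj) ▷ obj = MonObj.mul (X := obj) ≫ dag (MonObj.mul (X := obj))
  /-- `(id ⊗ m) ∘ (m† ⊗ id) = m† ∘ m` -/
  frobenius_right : dag (MonObj.mul (X := obj)) ▷ obj ≫ (α_ obj obj obj).hom ≫
      obj ◁ MonObj.mul (X := obj) = MonObj.mul (X := obj) ≫ dag (MonObj.mul (X := obj))

attribute [instance] ClassicalStructure.mon ClassicalStructure.comm

variable {Q} [DaggerDuals Q]

/-- The conjugation functor `f_* = (f†)* : A* ⟶ B*` on morphisms `f : A ⟶ B`. -/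
def conjMap {A B : Q} (f : A ⟶ B) : (ᘁA) ⟶ (ᘁB) := ᘁ(dag f)

theorem conjMap_id (A : Q) : conjMap (𝟙 A) = 𝟙 (ᘁA) := by
  simp [conjMap, dag_id]

theorem conjMap_comp {A B C : Q} (f : A ⟶ B) (g : B ⟶ C) :
    conjMap (f ≫ g) = conjMap f ≫ conjMap g := by
  simp [conjMap, dag_comp, comp_leftAdjointMate]

namespace ClassicalStructure

/-- The linear involution `s : A ⟶ A*` of a classical structure,
`s = (id ⊗ (u† ∘ m)) ∘ (ε_A ⊗ id)`, where `ε_A : I ⟶ A* ⊗ A` is the duality morphism. -/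
def involution (A : ClassicalStructure Q) : A.obj ⟶ (ᘁA.obj) :=
  (λ_ A.obj).inv ≫ η_ (ᘁA.obj) A.obj ▷ A.obj ≫ (α_ (ᘁA.obj) A.obj A.obj).hom ≫
    (ᘁA.obj) ◁ (MonObj.mul (X := A.obj) ≫ dag (MonObj.one (X := A.obj))) ≫ (ρ_ (ᘁA.obj)).hom

/-- Involution-preserving monoid homomorphisms. -/
@[ext]
structure Hom (A B : ClassicalStructure Q) where
  /-- The underlying morphism. -/
  hom : A.obj ⟶ B.obj
  isMonHom : IsMonHom hom
  involution_preserving : hom ≫ B.involution = A.involution ≫ conjMap hom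

/-- The category `C(Q)` of classical structures in `Q` and involution-preserving monoid
homomorphisms. -/
instance : Category (ClassicalStructure Q) where
  Hom := Hom
  id A := ⟨𝟙 A.obj, inferInstance, by simp [conjMap_id]⟩
  comp f g := ⟨f.hom ≫ g.hom, by
      have := f.isMonHom
      have := g.isMonHom
      infer_instance, by
      rw [Category.assoc, g.involution_preserving, ← Category.assoc, f.involution_preserving,
        Category.assoc, conjMap_comp]⟩
  id_comp f := Hom.ext (Category.id_comp _)
  comp_id f := Hom.ext (Category.comp_id _)
  assoc f g h := Hom.ext (Category.assoc _ _ _)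

end ClassicalStructure

end ClassicalStructures

/-! ### The category of finite-dimensional complex Hilbert spaces -/

/-- Finite-dimensional complex Hilbert spaces (completeness is automatic). -/
structure FinHilb where
  /-- The underlying type. -/
  carrier : Type
  [normed : NormedAddCommGroup carrier]
  [innerProduct : InnerProductSpace ℂ carrier]
  [finite : FiniteDimensional ℂ carrier]

noncomputable section

namespace FinHilb

instance : CoeSort FinHilb Type := ⟨carrier⟩

attribute [instance] normed innerProduct finite

/-- Morphisms of Hilbert spaces are the linear maps. -/
@[ext]
structure Hom (A B : FinHilb) where
  /-- The underlying linear map. -/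
  hom : A →ₗ[ℂ] B

instance : Category FinHilb where
  Hom := Hom
  id _ := ⟨LinearMap.id⟩
  comp f g := ⟨g.hom ∘ₗ f.hom⟩

@[ext]
theorem hom_ext {A B : FinHilb} {f g : A ⟶ B} (h : f.hom = g.hom) : f = g := Hom.ext h

@[simp] theorem id_hom (A : FinHilb) : (𝟙 A : A ⟶ A).hom = LinearMap.id := rfl

@[simp] theorem comp_hom {A B C : FinHilb} (f : A ⟶ B) (g : B ⟶ C) :
    (f ≫ g).hom = g.hom ∘ₗ f.hom := rfl

/-- A linear equivalence gives an isomorphism. -/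
@[simps]
def isoOfEquiv {A B : FinHilb} (e : A ≃ₗ[ℂ] B) : A ≅ B where
  hom := ⟨e.toLinearMap⟩
  inv := ⟨e.symm.toLinearMap⟩
  hom_inv_id := by ext x; simp
  inv_hom_id := by ext x; simp

/-- The tensor product of Hilbert spaces, with the usual inner product
`⟪a ⊗ b, c ⊗ d⟫ = ⟪a, c⟫ ⟪b, d⟫`. -/
instance : MonoidalCategoryStruct FinHilb where
  tensorObj A B := ⟨A ⊗[ℂ] B⟩
  whiskerLeft A _ _ f := ⟨f.hom.lTensor A⟩
  whiskerRight f B := ⟨f.hom.rTensor B⟩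
  tensorHom f g := ⟨TensorProduct.map f.hom g.hom⟩
  tensorUnit := ⟨ℂ⟩
  associator A B C := isoOfEquiv (TensorProduct.assoc ℂ A B C)
  leftUnitor A := isoOfEquiv (TensorProduct.lid ℂ A)
  rightUnitor A := isoOfEquiv (TensorProduct.rid ℂ A)

@[simp] theorem whiskerLeft_hom (A : FinHilb) {B C : FinHilb} (f : B ⟶ C) :
    (A ◁ f).hom = f.hom.lTensor A := rfl

@[simp] theorem whiskerRight_hom {A B : FinHilb} (f : A ⟶ B) (C : FinHilb) :
    (f ▷ C).hom = f.hom.rTensor C := rfl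

@[simp] theorem tensorHom_hom {A B C D : FinHilb} (f : A ⟶ B) (g : C ⟶ D) :
    (f ⊗ₘ g).hom = TensorProduct.map f.hom g.hom := rfl

@[simp] theorem associator_hom_hom (A B C : FinHilb) :
    (α_ A B C).hom.hom = (TensorProduct.assoc ℂ A B C).toLinearMap := rfl

@[simp] theorem associator_inv_hom (A B C : FinHilb) :
    (α_ A B C).inv.hom = (TensorProduct.assoc ℂ A B C).symm.toLinearMap := rfl

@[simp] theorem leftUnitor_hom_hom (A : FinHilb) :
    (λ_ A).hom.hom = (TensorProduct.lid ℂ A).toLinearMap := rfl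

@[simp] theorem leftUnitor_inv_hom (A : FinHilb) :
    (λ_ A).inv.hom = (TensorProduct.lid ℂ A).symm.toLinearMap := rfl

@[simp] theorem rightUnitor_hom_hom (A : FinHilb) :
    (ρ_ A).hom.hom = (TensorProduct.rid ℂ A).toLinearMap := rfl

@[simp] theorem rightUnitor_inv_hom (A : FinHilb) :
    (ρ_ A).inv.hom = (TensorProduct.rid ℂ A).symm.toLinearMap := rfl

instance : MonoidalCategory FinHilb where
  tensorHom_def f g := hom_ext (TensorProduct.ext' fun _ _ => rfl)
  id_tensorHom_id _ _ := hom_ext (TensorProduct.ext' fun _ _ => rfl)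
  tensorHom_comp_tensorHom _ _ _ _ := hom_ext (TensorProduct.ext' fun _ _ => rfl)
  whiskerLeft_id _ _ := hom_ext (TensorProduct.ext' fun _ _ => rfl)
  id_whiskerRight _ _ := hom_ext (TensorProduct.ext' fun _ _ => rfl)
  associator_naturality _ _ _ := hom_ext (TensorProduct.ext_threefold fun _ _ _ => rfl)
  leftUnitor_naturality f := hom_ext (TensorProduct.ext' fun x y =>
    (f.hom.map_smul x y).symm)
  rightUnitor_naturality f := hom_ext (TensorProduct.ext' fun x y =>
    (f.hom.map_smul y x).symm)
  pentagon _ _ _ _ := hom_ext (TensorProduct.ext_fourfold fun _ _ _ _ => rfl)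
  triangle A B := hom_ext (TensorProduct.ext_threefold fun x y z => by
    change x ⊗ₜ[ℂ] ((show ℂ from y) • z) = ((show ℂ from y) • x) ⊗ₜ[ℂ] z
    exact (TensorProduct.smul_tmul _ _ _).symm)

instance : BraidedCategory FinHilb where
  braiding A B := isoOfEquiv (TensorProduct.comm ℂ A B)
  braiding_naturality_right _ _ _ _ := hom_ext (TensorProduct.ext' fun _ _ => rfl)
  braiding_naturality_left _ _ := hom_ext (TensorProduct.ext' fun _ _ => rfl)
  hexagon_forward _ _ _ := hom_ext (TensorProduct.ext_threefold fun _ _ _ => rfl)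
  hexagon_reverse A B C := hom_ext (by
    apply TensorProduct.ext
    ext x : 1
    exact TensorProduct.ext' fun _ _ => rfl)

@[simp] theorem braiding_hom_hom (A B : FinHilb) :
    (β_ A B).hom.hom = (TensorProduct.comm ℂ A B).toLinearMap := rfl

theorem adjoint_equiv {E F : Type*} [NormedAddCommGroup E] [InnerProductSpace ℂ E]
    [FiniteDimensional ℂ E] [NormedAddCommGroup F] [InnerProductSpace ℂ F]
    [FiniteDimensional ℂ F] (e : E ≃ₗᵢ[ℂ] F) :
    LinearMap.adjoint e.toLinearEquiv.toLinearMap = e.symm.toLinearEquiv.toLinearMap := by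
  symm
  rw [LinearMap.eq_adjoint_iff]
  intro x y
  simpa using (e.inner_map_map (e.symm x) y).symm

/-- The dagger on Hilbert spaces is the adjoint of linear maps. -/
instance : BraidedDaggerCategory FinHilb where
  dag f := ⟨LinearMap.adjoint f.hom⟩
  dag_id A := hom_ext (by simp)
  dag_comp f g := hom_ext (by simp [LinearMap.adjoint_comp])
  dag_dag f := hom_ext (by simp)
  dag_tensorHom f g := hom_ext (TensorProduct.adjoint_map f.hom g.hom)
  dag_associator A B C := hom_ext (adjoint_equiv (TensorProduct.assocIsometry ℂ A B C))
  dag_leftUnitor A := hom_ext (adjoint_equiv (TensorProduct.lidIsometry ℂ A))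
  dag_rightUnitor A := hom_ext (adjoint_equiv (TensorProduct.ridIsometry ℂ A))
  dag_braiding A B := hom_ext (adjoint_equiv (TensorProduct.commIsometry ℂ A B))

@[simp] theorem dag_hom {A B : FinHilb} (f : A ⟶ B) : (dag f).hom = LinearMap.adjoint f.hom := rfl

/-- The inner product on the dual space `A*`: `⟪φ, ψ⟫ = ⟪b, a⟫` when `φ = ⟪a, ·⟫` and
`ψ = ⟪b, ·⟫`. It induces the operator norm. -/
instance dualInner (A : FinHilb) : InnerProductSpace ℂ (StrongDual ℂ A) where
  inner φ ψ := Inner.inner ℂ ((InnerProductSpace.toDual ℂ A).symm ψ)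
    ((InnerProductSpace.toDual ℂ A).symm φ)
  norm_sq_eq_re_inner φ := by
    rw [← (InnerProductSpace.toDual ℂ A).symm.norm_map φ]
    exact norm_sq_eq_re_inner _
  conj_inner_symm φ ψ := inner_conj_symm _ _
  add_left φ ψ χ := by simp
  smul_left φ ψ r := by
    rw [(InnerProductSpace.toDual ℂ A).symm.map_smulₛₗ, inner_smul_right]

theorem dualInner_def {A : FinHilb} (φ ψ : StrongDual ℂ A) :
    Inner.inner ℂ φ ψ = Inner.inner ℂ ((InnerProductSpace.toDual ℂ A).symm ψ)
      ((InnerProductSpace.toDual ℂ A).symm φ) := rfl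

/-- The dual Hilbert space. -/
abbrev dual (A : FinHilb) : FinHilb := ⟨StrongDual ℂ A⟩

/-- The evaluation `A ⊗ A* ⟶ ℂ`, `a ⊗ φ ↦ φ a`. -/
def eval (A : FinHilb) : A ⊗ dual A ⟶ 𝟙_ FinHilb :=
  ⟨TensorProduct.lift (ContinuousLinearMap.coeLM ℂ : StrongDual ℂ A →ₗ[ℂ] A →ₗ[ℂ] ℂ).flip⟩

/-- The coevaluation `ℂ ⟶ A* ⊗ A`, `1 ↦ ∑ i, ⟪e i, ·⟫ ⊗ e i` for an orthonormal basis `e`. -/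
def coeval (A : FinHilb) : 𝟙_ FinHilb ⟶ dual A ⊗ A :=
  ⟨LinearMap.toSpanSingleton ℂ (StrongDual ℂ A ⊗[ℂ] A)
    (∑ i, InnerProductSpace.toDual ℂ A (stdOrthonormalBasis ℂ A i) ⊗ₜ[ℂ]
      stdOrthonormalBasis ℂ A i)⟩

theorem coeval_one (A : FinHilb) : (coeval A).hom (1 : ℂ) =
    ∑ i, InnerProductSpace.toDual ℂ A (stdOrthonormalBasis ℂ A i) ⊗ₜ[ℂ]
      stdOrthonormalBasis ℂ A i := by
  exact one_smul ℂ _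

theorem eval_tmul (A : FinHilb) (a : A) (φ : StrongDual ℂ A) :
    (eval A).hom (a ⊗ₜ φ) = φ a := rfl

theorem sum_toDual (A : FinHilb) (φ : StrongDual ℂ A) :
    ∑ i, φ (stdOrthonormalBasis ℂ A i) •
      InnerProductSpace.toDual ℂ A (stdOrthonormalBasis ℂ A i) = φ := by
  ext a
  conv_rhs => rw [← (stdOrthonormalBasis ℂ A).sum_repr' a, map_sum]
  simp [mul_comm]

instance exactPairing (A : FinHilb) : ExactPairing (dual A) A where
  coevaluation' := coeval A
  evaluation' := eval A
  coevaluation_evaluation' := by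
    refine hom_ext (TensorProduct.ext (LinearMap.ext fun a => LinearMap.ext_ring ?_))
    change ((eval A).hom.rTensor A) ((TensorProduct.assoc ℂ A (dual A) A).symm
      (a ⊗ₜ[ℂ] ((coeval A).hom (1 : ℂ)))) = (1 : ℂ) ⊗ₜ[ℂ] ((1 : ℂ) • a)
    rw [coeval_one, one_smul, TensorProduct.tmul_sum, map_sum, map_sum]
    conv_rhs => rw [← (stdOrthonormalBasis ℂ A).sum_repr' a, TensorProduct.tmul_sum]
    refine Finset.sum_congr rfl fun i _ => ?_
    rw [TensorProduct.tmul_smul, TensorProduct.smul_tmul', smul_eq_mul, mul_one]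
    rfl
  evaluation_coevaluation' := by
    refine hom_ext (TensorProduct.ext (LinearMap.ext_ring (LinearMap.ext fun φ => ?_)))
    change ((eval A).hom.lTensor (dual A)) ((TensorProduct.assoc ℂ (dual A) A (dual A))
      (((coeval A).hom (1 : ℂ)) ⊗ₜ[ℂ] φ)) = ((1 : ℂ) • φ) ⊗ₜ[ℂ] (1 : ℂ)
    rw [coeval_one, one_smul, TensorProduct.sum_tmul, map_sum, map_sum]
    conv_rhs => rw [← sum_toDual A φ, TensorProduct.sum_tmul]
    refine Finset.sum_congr rfl fun i _ => ?_
    rw [TensorProduct.smul_tmul, smul_eq_mul, mul_one]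
    rfl

instance (A : FinHilb) : HasLeftDual A := ⟨dual A⟩

/-- `f*` is precomposition with `f`. -/
theorem leftAdjointMate_apply {A B : FinHilb} (f : A ⟶ B) (φ : StrongDual ℂ B) :
    (ᘁf).hom φ = φ.comp (LinearMap.toContinuousLinearMap f.hom) := by
  change TensorProduct.rid ℂ (dual A) (((eval B).hom.lTensor (dual A))
    ((TensorProduct.assoc ℂ (dual A) B (dual B)) (((f.hom.lTensor (dual A)).rTensor (dual B))
      (((coeval A).hom (1 : ℂ)) ⊗ₜ[ℂ] φ)))) = _
  rw [coeval_one, TensorProduct.sum_tmul, map_sum, map_sum, map_sum, map_sum]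
  exact sum_toDual A (φ.comp (LinearMap.toContinuousLinearMap f.hom))

instance : DaggerDuals FinHilb where
  leftDual A := inferInstance
  dag_dual {A B} f := by
    refine hom_ext ?_
    symm
    refine (LinearMap.eq_adjoint_iff _ _).2 fun φ ψ => ?_
    obtain ⟨a, rfl⟩ := (InnerProductSpace.toDual ℂ A).surjective φ
    obtain ⟨b, rfl⟩ := (InnerProductSpace.toDual ℂ B).surjective ψ
    rw [leftAdjointMate_apply, leftAdjointMate_apply]
    have h₁ : ((InnerProductSpace.toDual ℂ A) a).comp
        (LinearMap.toContinuousLinearMap (dag f).hom) = InnerProductSpace.toDual ℂ B (f.hom a) := by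
      ext x
      simp [LinearMap.adjoint_inner_right]
    have h₂ : ((InnerProductSpace.toDual ℂ B) b).comp (LinearMap.toContinuousLinearMap f.hom) =
        InnerProductSpace.toDual ℂ A (LinearMap.adjoint f.hom b) := by
      ext x
      simp [LinearMap.adjoint_inner_left]
    rw [h₁, h₂, dualInner_def, dualInner_def]
    simp only [LinearIsometryEquiv.symm_apply_apply]
    exact (LinearMap.adjoint_inner_left f.hom a b).symm

end FinHilb

end

/-! The Frobenius law forces the adjoint of every multiplication operator to be a multiplication
operator (`exists_adjoint`), so `A` acts on itself by a commutative algebra of operators closed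
under adjoints. Such an algebra has no nilpotents (`eq_zero_of_mul_self`), and a reduced
finite-dimensional commutative `ℂ`-algebra is `X → ℂ`, with `X` its set of maximal ideals
(`exists_algEquiv_fun`).

The involution restricts nothing: under Riesz duality `s` becomes `conj` (`involution_apply`), which
characters carry to complex conjugation; since characters separate points, every algebra
homomorphism commutes with `conj` (`map_conj`). Hence morphisms are just algebra homomorphisms, and
those between function algebras are pullbacks because characters are evaluations
(`exists_algHom_eq_eval`). Isomorphisms need not be unitary, so one inner product on `X → ℂ`
represents all of them. -/

noncomputable section

/-! ### Classical structures as reduced commutative algebras -/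

namespace ClassicalStructure

/-- The underlying space of a classical structure on Hilbert spaces, with its algebra structure. -/
def Alg (A : ClassicalStructure FinHilb) : Type := A.obj.carrier

variable (A B : ClassicalStructure FinHilb)

instance : NormedAddCommGroup A.Alg := A.obj.normed

instance : InnerProductSpace ℂ A.Alg := A.obj.innerProduct

instance : FiniteDimensional ℂ A.Alg := A.obj.finite

variable {A B}

/-- The multiplication of a classical structure, as a linear map. -/
def mulLin (A : ClassicalStructure FinHilb) : A.Alg ⊗[ℂ] A.Alg →ₗ[ℂ] A.Alg :=
  (MonObj.mul (X := A.obj)).hom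

instance : Mul A.Alg := ⟨fun x y => A.mulLin (x ⊗ₜ y)⟩

instance : One A.Alg := ⟨(MonObj.one (X := A.obj)).hom (1 : ℂ)⟩

theorem mul_def (x y : A.Alg) : x * y = A.mulLin (x ⊗ₜ y) := rfl

theorem alg_mul_assoc (x y z : A.Alg) : x * y * z = x * (y * z) :=
  LinearMap.congr_fun (congrArg FinHilb.Hom.hom (MonObj.mul_assoc A.obj)) ((x ⊗ₜ y) ⊗ₜ z)

theorem alg_mul_comm (x y : A.Alg) : x * y = y * x :=
  LinearMap.congr_fun (congrArg FinHilb.Hom.hom (IsCommMonObj.mul_comm A.obj)) (y ⊗ₜ x)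

theorem alg_one_mul (x : A.Alg) : 1 * x = x :=
  (LinearMap.congr_fun (congrArg FinHilb.Hom.hom (MonObj.one_mul A.obj)) ((1 : ℂ) ⊗ₜ x)).trans
    (one_smul ℂ x)

theorem alg_mul_add (x y z : A.Alg) : x * (y + z) = x * y + x * z := by
  simp only [mul_def, TensorProduct.tmul_add, map_add]

theorem alg_smul_mul (c : ℂ) (x y : A.Alg) : c • x * y = c • (x * y) := by
  simp only [mul_def, ← TensorProduct.smul_tmul', map_smul]

/-- The underlying linear maps of the second Frobenius law. -/
theorem frobenius_lin (A : ClassicalStructure FinHilb) :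
    A.mulLin.lTensor A.Alg ∘ₗ (TensorProduct.assoc ℂ A.Alg A.Alg A.Alg).toLinearMap ∘ₗ
      (LinearMap.adjoint A.mulLin).rTensor A.Alg = LinearMap.adjoint A.mulLin ∘ₗ A.mulLin :=
  congrArg FinHilb.Hom.hom A.frobenius_right

theorem frobenius_apply (x y : A.Alg) :
    A.mulLin.lTensor A.Alg (TensorProduct.assoc ℂ A.Alg A.Alg A.Alg
      (LinearMap.adjoint A.mulLin x ⊗ₜ[ℂ] y)) = LinearMap.adjoint A.mulLin (x * y) :=
  LinearMap.congr_fun A.frobenius_lin (x ⊗ₜ y)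

/-- The adjoint of a multiplication operator is a multiplication operator. -/
theorem exists_adjoint (c : A.Alg) :
    ∃ c' : A.Alg, ∀ b d : A.Alg, inner ℂ (c' * b) d = inner ℂ b (c * d) := by
  -- Pairing the first leg of `t = ∑ p ⊗ q` with `c` leaves multiplication by `c' = ∑ ⟪c, p⟫ • q`.
  have key : ∀ t : A.Alg ⊗[ℂ] A.Alg, ∃ c' : A.Alg, ∀ b d : A.Alg, inner ℂ
      (A.mulLin.lTensor A.Alg (TensorProduct.assoc ℂ A.Alg A.Alg A.Alg (t ⊗ₜ[ℂ] b)))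
      (c ⊗ₜ[ℂ] d) = inner ℂ (A.mulLin (c' ⊗ₜ b)) d := by
    intro t
    induction t with
    | zero => exact ⟨0, fun b d => by simp⟩
    | tmul p q =>
      refine ⟨(inner ℂ c p : ℂ) • q, fun b d => ?_⟩
      rw [TensorProduct.assoc_tmul, LinearMap.lTensor_tmul, TensorProduct.inner_tmul,
        ← TensorProduct.smul_tmul', map_smul, inner_smul_left, inner_conj_symm]
    | add s t hs ht =>
      obtain ⟨s', hs⟩ := hs
      obtain ⟨t', ht⟩ := ht
      refine ⟨s' + t', fun b d => ?_⟩
      rw [TensorProduct.add_tmul, map_add, map_add, inner_add_left, hs, ht,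
        TensorProduct.add_tmul, map_add, inner_add_left]
  -- For `t = m†(1)` the Frobenius law gives `(id ⊗ m)(m†(1) ⊗ b) = m†(b)`, and `⟪m†(b), c ⊗ d⟫ =
  -- ⟪b, c * d⟫`.
  obtain ⟨c', hc⟩ := key (LinearMap.adjoint A.mulLin 1)
  refine ⟨c', fun b d => ?_⟩
  rw [mul_def, ← hc, frobenius_apply, LinearMap.adjoint_inner_left, alg_one_mul, mul_def]

instance : CommRing A.Alg where
  __ := (inferInstance : AddCommGroup A.Alg)
  mul := (· * ·)
  one := 1
  mul_assoc := alg_mul_assoc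
  mul_comm := alg_mul_comm
  one_mul := alg_one_mul
  mul_one x := by rw [alg_mul_comm, alg_one_mul]
  left_distrib := alg_mul_add
  right_distrib x y z := by
    rw [alg_mul_comm, alg_mul_add, alg_mul_comm z, alg_mul_comm z]
  zero_mul x := by simp only [mul_def, TensorProduct.zero_tmul, map_zero]
  mul_zero x := by simp only [mul_def, TensorProduct.tmul_zero, map_zero]

instance : Algebra ℂ A.Alg :=
  Algebra.ofModule alg_smul_mul fun c x y => by
    rw [mul_comm, alg_smul_mul, mul_comm]

/-- The involution of the algebra: multiplication by `conj x` is adjoint to multiplication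
by `x`. -/
def conj (x : A.Alg) : A.Alg := (exists_adjoint x).choose

theorem inner_conj_mul (x y z : A.Alg) : inner ℂ (conj x * y) z = inner ℂ y (x * z) :=
  (exists_adjoint x).choose_spec y z

/-- The C*-argument: with `x* = conj x`, `‖x* x‖² = ⟪x, x* (x x)⟫ = 0`, and then `‖x‖² = ⟪x* x, 1⟫ =
0`. -/
theorem eq_zero_of_mul_self (x : A.Alg) (hx : x * x = 0) : x = 0 := by
  have h₁ : conj x * x = 0 := by
    rw [← inner_self_eq_zero (𝕜 := ℂ), inner_conj_mul, mul_left_comm, hx, mul_zero,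
      inner_zero_right]
  have h₂ := inner_conj_mul x x 1
  rw [h₁, inner_zero_left, mul_one] at h₂
  exact inner_self_eq_zero.1 h₂.symm

instance : IsReduced A.Alg :=
  (isReduced_iff_pow_one_lt 2 one_lt_two).2 fun x hx => eq_zero_of_mul_self x (by rwa [← sq])

end ClassicalStructure

/-! ### Function algebras and their characters -/

/-- A reduced finite-dimensional commutative algebra over an algebraically closed field is an
algebra of functions on a finite set. -/
theorem exists_algEquiv_fun (K R : Type*) [Field K] [IsAlgClosed K] [CommRing R] [Algebra K R]
    [FiniteDimensional K R] [IsReduced R] :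
    Finite (MaximalSpectrum R) ∧ Nonempty (R ≃ₐ[K] (MaximalSpectrum R → K)) := by
  have : IsArtinianRing R := IsArtinianRing.of_finite K R
  refine ⟨inferInstance, ⟨?_⟩⟩
  -- A reduced Artinian ring is the product of its residue fields; each is finite over `K`, hence
  -- equal to `K`.
  refine ((IsArtinianRing.equivPi R).restrictScalars K).trans
    (AlgEquiv.piCongrRight fun I => (AlgEquiv.ofBijective (Algebra.ofId K (R ⧸ I.asIdeal)) ?_).symm)
  exact IsAlgClosed.algebraMap_bijective_of_isIntegral

/-- Algebra homomorphisms from functions on a finite set to a field are evaluations. -/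
theorem exists_algHom_eq_eval {K X : Type*} [Field K] [Finite X] (χ : (X → K) →ₐ[K] K) :
    ∃ x, ∀ f, χ f = f x := by
  classical
  have := Fintype.ofFinite X
  -- The indicators sum to `1`, so `χ` is nonzero on some `δ_x`; then `f * δ_x = f x • δ_x`
  -- determines `χ f`.
  obtain ⟨x, hx⟩ : ∃ x, χ (Pi.single x 1) ≠ 0 := by
    by_contra! h
    have h1 : χ (∑ x, Pi.single x 1) = 0 := by simp [h]
    rw [show (∑ x : X, Pi.single x (1 : K)) = 1 from Finset.univ_sum_single 1, map_one] at h1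
    exact one_ne_zero h1
  refine ⟨x, fun f => mul_right_cancel₀ hx ?_⟩
  rw [← map_mul, ← smul_eq_mul (f x), ← map_smul]
  congr 1
  ext y
  by_cases h : y = x
  · subst h; simp
  · simp [h]

/-! ### Automatic preservation of the involution -/

namespace ClassicalStructure
variable {A B : ClassicalStructure FinHilb}

/-- The Riesz vector `v` of `χ` is a common eigenvector of the operators `conj x * ·`, with
eigenvalue the conjugate of `χ x`. Applying `χ` to the eigenvector equation suffices, as `χ v = ‖v‖²
≠ 0`. -/
theorem algHom_conj (χ : A.Alg →ₐ[ℂ] ℂ) (x : A.Alg) : χ (conj x) = starRingEnd ℂ (χ x) := by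
  obtain ⟨v, hv⟩ := (InnerProductSpace.toDual ℂ A.Alg).surjective
    (LinearMap.toContinuousLinearMap χ.toLinearMap)
  have hv' : ∀ y, inner ℂ v y = χ y := fun y => DFunLike.congr_fun hv y
  have hχ : χ v ≠ 0 := by
    intro h
    rw [← hv', inner_self_eq_zero] at h
    have := hv' 1
    rw [h, inner_zero_left, map_one] at this
    exact zero_ne_one this
  have hx : conj x * v = starRingEnd ℂ (χ x) • v := by
    refine ext_inner_right ℂ fun y => ?_
    rw [inner_conj_mul, inner_smul_left, hv', hv', map_mul, Complex.conj_conj]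
  refine mul_right_cancel₀ hχ ?_
  rw [← map_mul, hx, map_smul, smul_eq_mul]

/-- Characters of `B` separate points, and composing them with `f` gives characters of `A`, so
`algHom_conj` applies on both sides. -/
theorem map_conj (f : A.Alg →ₐ[ℂ] B.Alg) (x : A.Alg) : f (conj x) = conj (f x) := by
  obtain ⟨-, ⟨e⟩⟩ := exists_algEquiv_fun ℂ B.Alg
  refine e.injective (funext fun i => ?_)
  have h₁ := algHom_conj (((Pi.evalAlgHom ℂ (fun _ => ℂ) i).comp e.toAlgHom).comp f) x
  have h₂ := algHom_conj ((Pi.evalAlgHom ℂ (fun _ => ℂ) i).comp e.toAlgHom) (f x)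
  exact h₁.trans h₂.symm

/-- The unit of a classical structure, as a linear map. -/
def oneLin (A : ClassicalStructure FinHilb) : ℂ →ₗ[ℂ] A.Alg := (MonObj.one (X := A.obj)).hom

theorem counit_mul (y x : A.Alg) :
    LinearMap.adjoint A.oneLin (y * x) = inner ℂ (conj x) y := by
  have h : inner ℂ (1 : ℂ) (LinearMap.adjoint A.oneLin (y * x)) = inner ℂ (1 : A.Alg) (y * x) :=
    LinearMap.adjoint_inner_right _ _ _
  rw [mul_comm y x, ← inner_conj_mul, mul_one] at h
  rw [← h, mul_comm y x]
  simp

/-- The coefficient of `s x` at `⟪e i, ·⟫` is `u†(e i * x) = ⟪conj x, e i⟫`, which is the value of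
`⟪conj x, ·⟫` at `e i`. -/
theorem involution_apply (x : A.Alg) :
    A.involution.hom x = InnerProductSpace.toDual ℂ A.obj (conj x) := by
  change TensorProduct.rid ℂ (FinHilb.dual A.obj)
    (((MonObj.mul (X := A.obj) ≫ dag (MonObj.one (X := A.obj))).hom.lTensor
      (FinHilb.dual A.obj)) ((TensorProduct.assoc ℂ (FinHilb.dual A.obj) A.obj A.obj)
        (((FinHilb.coeval A.obj).hom (1 : ℂ)) ⊗ₜ[ℂ] (show A.obj from x)))) = _
  rw [FinHilb.coeval_one, TensorProduct.sum_tmul, map_sum, map_sum, map_sum]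
  refine Eq.trans ?_ (FinHilb.sum_toDual A.obj _)
  refine Finset.sum_congr rfl fun i _ => ?_
  refine congrArg (fun c : ℂ => c • InnerProductSpace.toDual ℂ A.obj
    (stdOrthonormalBasis ℂ A.obj i)) ?_
  exact counit_mul _ x

theorem conjMap_toDual {A B : FinHilb} (f : A ⟶ B) (a : A) :
    (conjMap f).hom (InnerProductSpace.toDual ℂ A a) = InnerProductSpace.toDual ℂ B (f.hom a) := by
  refine (FinHilb.leftAdjointMate_apply _ _).trans ?_
  refine ContinuousLinearMap.ext fun x => ?_
  simp [LinearMap.adjoint_inner_right]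

/-- Algebra homomorphisms preserve the involution, hence are morphisms of classical structures. -/
def ofAlgHom (f : A.Alg →ₐ[ℂ] B.Alg) : A ⟶ B where
  hom := ⟨f.toLinearMap⟩
  isMonHom :=
    { one_hom := FinHilb.hom_ext (LinearMap.ext_ring (map_one f))
      mul_hom := FinHilb.hom_ext (TensorProduct.ext' (map_mul f)) }
  involution_preserving := FinHilb.hom_ext (LinearMap.ext fun x => by
    refine ((involution_apply (f x)).trans ?_).trans
      ((congrArg _ (involution_apply x)).trans (conjMap_toDual _ _)).symm
    exact congrArg (InnerProductSpace.toDual ℂ B.obj) (map_conj f x).symm)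

/-- The algebra homomorphism underlying a morphism of classical structures. -/
def toAlgHom (f : A ⟶ B) : A.Alg →ₐ[ℂ] B.Alg :=
  AlgHom.ofLinearMap (f.hom.hom : A.Alg →ₗ[ℂ] B.Alg)
    (LinearMap.congr_fun (congrArg FinHilb.Hom.hom f.isMonHom.one_hom) (1 : ℂ))
    fun x y => LinearMap.congr_fun (congrArg FinHilb.Hom.hom f.isMonHom.mul_hom) (x ⊗ₜ y)

/-- Isomorphic algebras give isomorphic classical structures. -/
def isoOfAlgEquiv (e : A.Alg ≃ₐ[ℂ] B.Alg) : A ≅ B where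
  hom := ofAlgHom e.toAlgHom
  inv := ofAlgHom e.symm.toAlgHom
  hom_inv_id := Hom.ext (FinHilb.hom_ext (LinearMap.ext e.symm_apply_apply))
  inv_hom_id := Hom.ext (FinHilb.hom_ext (LinearMap.ext e.apply_symm_apply))

end ClassicalStructure

/-! ### The Hilbert space of functions on a finite set -/

namespace FinHilb
variable (X : Type)

/-- The Hilbert space of functions on a finite set. -/
abbrev l2 [Fintype X] : FinHilb := ⟨EuclideanSpace ℂ X⟩

/-- Pointwise multiplication of functions. -/
def pointwiseMul : EuclideanSpace ℂ X ⊗[ℂ] EuclideanSpace ℂ X →ₗ[ℂ] EuclideanSpace ℂ X :=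
  TensorProduct.lift (LinearMap.mk₂ ℂ (fun f g => WithLp.toLp 2 fun x => f x * g x)
    (fun _ _ _ => by ext; simp [add_mul]) (fun _ _ _ => by ext; simp [mul_assoc])
    (fun _ _ _ => by ext; simp [mul_add]) (fun _ _ _ => by ext; simp [mul_left_comm]))

variable {X}

@[simp]
theorem pointwiseMul_tmul (f g : EuclideanSpace ℂ X) (x : X) :
    pointwiseMul X (f ⊗ₜ g) x = f x * g x := rfl

-- The comultiplication copies the basis vectors `δ_x`; both Frobenius laws then reduce to a
-- termwise check.
open Classical in
theorem adjoint_pointwiseMul_apply [Fintype X] (f : EuclideanSpace ℂ X) :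
    LinearMap.adjoint (pointwiseMul X) f =
      ∑ x, (f x • EuclideanSpace.single x (1 : ℂ)) ⊗ₜ[ℂ] EuclideanSpace.single x (1 : ℂ) := by
  refine ext_inner_right ℂ fun t => ?_
  rw [LinearMap.adjoint_inner_left]
  induction t with
  | zero => simp
  | add s t hs ht => rw [map_add, inner_add_right, inner_add_right, hs, ht]
  | tmul g h =>
    rw [sum_inner, PiLp.inner_apply]
    refine Finset.sum_congr rfl fun x _ => ?_
    rw [TensorProduct.inner_tmul, inner_smul_left, EuclideanSpace.inner_single_left,
      EuclideanSpace.inner_single_left]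
    simp [mul_comm, mul_assoc, mul_left_comm]

open Classical in
theorem pointwiseMul_single (f : EuclideanSpace ℂ X) (x : X) :
    pointwiseMul X (f ⊗ₜ EuclideanSpace.single x (1 : ℂ)) = f x • EuclideanSpace.single x 1 := by
  ext y
  by_cases h : y = x
  · subst h; simp
  · simp [h]

open Classical in
theorem pointwiseMul_single' (f : EuclideanSpace ℂ X) (x : X) :
    pointwiseMul X (EuclideanSpace.single x (1 : ℂ) ⊗ₜ f) = f x • EuclideanSpace.single x 1 := by
  ext y
  by_cases h : y = x
  · subst h; simp
  · simp [h]

variable [Fintype X]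

instance : MonObj (l2 X) where
  one := ⟨LinearMap.toSpanSingleton ℂ (EuclideanSpace ℂ X) (WithLp.toLp 2 1)⟩
  mul := ⟨pointwiseMul X⟩
  one_mul := hom_ext (TensorProduct.ext (LinearMap.ext_ring (LinearMap.ext fun f => by
    change pointwiseMul X (((1 : ℂ) • WithLp.toLp 2 1) ⊗ₜ f) = (1 : ℂ) • f
    ext x
    simp)))
  mul_one := hom_ext (TensorProduct.ext (LinearMap.ext fun f => LinearMap.ext_ring (by
    change pointwiseMul X (f ⊗ₜ ((1 : ℂ) • WithLp.toLp 2 1)) = (1 : ℂ) • f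
    ext x
    simp)))
  mul_assoc := hom_ext (TensorProduct.ext_threefold fun f g h => by
    change pointwiseMul X (pointwiseMul X (f ⊗ₜ g) ⊗ₜ h) =
      pointwiseMul X (f ⊗ₜ pointwiseMul X (g ⊗ₜ h))
    ext x
    simp [mul_assoc])

instance : IsCommMonObj (l2 X) where
  mul_comm := hom_ext (TensorProduct.ext' fun f g => by
    change pointwiseMul X (g ⊗ₜ f) = pointwiseMul X (f ⊗ₜ g)
    ext x
    simp [mul_comm])

end FinHilb

/-! ### The equivalence with finite sets -/

namespace ClassicalStructure

/-- The classical structure of functions on a finite set, with pointwise multiplication. -/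
def functions (X : Type) [Fintype X] : ClassicalStructure FinHilb where
  obj := FinHilb.l2 X
  frobenius_left := FinHilb.hom_ext (TensorProduct.ext' fun f g => by
    change (FinHilb.pointwiseMul X).rTensor (EuclideanSpace ℂ X)
      ((TensorProduct.assoc ℂ _ _ _).symm (f ⊗ₜ LinearMap.adjoint (FinHilb.pointwiseMul X) g)) =
      LinearMap.adjoint (FinHilb.pointwiseMul X) (FinHilb.pointwiseMul X (f ⊗ₜ g))
    rw [FinHilb.adjoint_pointwiseMul_apply, FinHilb.adjoint_pointwiseMul_apply,
      TensorProduct.tmul_sum, map_sum, map_sum]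
    refine Finset.sum_congr rfl fun x _ => ?_
    rw [TensorProduct.assoc_symm_tmul, LinearMap.rTensor_tmul, TensorProduct.tmul_smul, map_smul,
      FinHilb.pointwiseMul_single, smul_smul, FinHilb.pointwiseMul_tmul, mul_comm])
  frobenius_right := FinHilb.hom_ext (TensorProduct.ext' fun f g => by
    change (FinHilb.pointwiseMul X).lTensor (EuclideanSpace ℂ X)
      ((TensorProduct.assoc ℂ _ _ _) (LinearMap.adjoint (FinHilb.pointwiseMul X) f ⊗ₜ g)) =
      LinearMap.adjoint (FinHilb.pointwiseMul X) (FinHilb.pointwiseMul X (f ⊗ₜ g))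
    rw [FinHilb.adjoint_pointwiseMul_apply, FinHilb.adjoint_pointwiseMul_apply,
      TensorProduct.sum_tmul, map_sum, map_sum]
    refine Finset.sum_congr rfl fun x _ => ?_
    rw [TensorProduct.assoc_tmul, LinearMap.lTensor_tmul, FinHilb.pointwiseMul_single',
      ← TensorProduct.smul_tmul, smul_smul, FinHilb.pointwiseMul_tmul, mul_comm])

/-- The algebra of the classical structure of functions on a finite set. -/
def functionsAlgEquiv (X : Type) [Fintype X] : (functions X).Alg ≃ₐ[ℂ] (X → ℂ) :=
  AlgEquiv.ofLinearEquiv (WithLp.linearEquiv 2 ℂ (X → ℂ) : (functions X).Alg ≃ₗ[ℂ] (X → ℂ))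
    (one_smul ℂ (1 : X → ℂ)) fun _ _ => rfl

/-- Pullback of functions along a map of finite sets. -/
def pullback {X Y : Type} [Fintype X] [Fintype Y] (g : X → Y) : functions Y ⟶ functions X :=
  ofAlgHom (((functionsAlgEquiv X).symm.toAlgHom.comp
    (AlgHom.pi fun x => Pi.evalAlgHom ℂ _ (g x))).comp
    (functionsAlgEquiv Y).toAlgHom)

theorem pullback_injective {X Y : Type} [Fintype X] [Fintype Y] :
    Function.Injective (pullback : (X → Y) → _) := by
  classical
  intro g h hgh
  funext x
  have h₁ : ∀ f : Y → ℂ, f (g x) = f (h x) := fun f =>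
    congrFun (congrArg (fun k => (functionsAlgEquiv X) (toAlgHom k ((functionsAlgEquiv Y).symm f)))
      hgh) x
  have h₂ := h₁ (Pi.single (g x) 1)
  by_contra hne
  rw [Pi.single_eq_same, Pi.single_eq_of_ne (Ne.symm hne)] at h₂
  exact one_ne_zero h₂

theorem pullback_surjective {X Y : Type} [Fintype X] [Fintype Y] :
    Function.Surjective (pullback : (X → Y) → _) := by
  intro k
  -- Following `k` by evaluation at `x` gives a character of the functions on `Y`, hence evaluation
  -- at a point `g x`.
  choose g hg using fun x => exists_algHom_eq_eval ((Pi.evalAlgHom ℂ (fun _ => ℂ) x).comp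
    (((functionsAlgEquiv X).toAlgHom.comp (toAlgHom k)).comp (functionsAlgEquiv Y).symm.toAlgHom))
  refine ⟨g, Hom.ext (FinHilb.hom_ext (LinearMap.ext fun f => ?_))⟩
  refine (functionsAlgEquiv X).injective (funext fun x => ?_)
  exact (hg x (functionsAlgEquiv Y f)).symm

attribute [local instance] FintypeCat.fintype

/-- The contravariant functor taking a finite set to the functions on it. -/
def functionsFunctor : FintypeCat.{0}ᵒᵖ ⥤ ClassicalStructure FinHilb where
  obj X := functions X.unop
  map g := pullback g.unop
  map_id _ := rfl
  map_comp _ _ := rfl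

instance : functionsFunctor.Faithful where
  map_injective hgh := Quiver.Hom.unop_inj
    (FintypeCat.hom_ext _ _ (congrFun (pullback_injective hgh)))

instance : functionsFunctor.Full where
  map_surjective k := by
    obtain ⟨g, hg⟩ := pullback_surjective k
    exact ⟨(FintypeCat.homMk g).op, hg⟩

instance : functionsFunctor.EssSurj where
  mem_essImage A := by
    obtain ⟨_, ⟨e⟩⟩ := exists_algEquiv_fun ℂ A.Alg
    -- The `Fintype` instance is given explicitly so as to match the one used by `functionsFunctor`.
    exact ⟨Opposite.op (FintypeCat.of (MaximalSpectrum A.Alg)),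
      ⟨(isoOfAlgEquiv (e.trans (@functionsAlgEquiv (MaximalSpectrum A.Alg)
        (FintypeCat.fintype (X := FintypeCat.of _))).symm)).symm⟩⟩

instance : functionsFunctor.IsEquivalence where

end ClassicalStructure

end

theorem mainTheorem3 : Nonempty (ClassicalStructure FinHilb ≌ FintypeCat.{0}ᵒᵖ) := by
  exact ⟨ClassicalStructure.functionsFunctor.asEquivalence.symm⟩
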